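/- A (right) Leibniz algebra over $\mathbb{C}$ is a complex vector space $L$ with a bilinear bracket satisfying $[x,[y,z]]=[[x,y],z]-[[x,z],y]$ for all $x,y,z\in L$. Let $L$ be a finite-dimensional complex Leibniz algebra and let $I$ be the two-sided ideal of $L$ generated by all squares $[x,x]$, $x\in L$. Right multiplication by elements of $I$ is zero, so $L/I$ is a Lie algebra and $I$ is a right $L/I$-module via $(x,a+I)\mapsto [x,a]$. (An irreducible module is a non-zero module whose only submodules are zero and itself.) Suppose, for some integer $m\ge 0$, that (a) $L/I\cong sl_2^1\oplus sl_2^2$ as Lie algebras, where $sl_2^1$ and $sl_2^2$ are two copies of $sl_2(\mathbb{C})$; (b) $I=I_{1,1}\oplus I_{1,2}$, where $I_{1,1}$ and $I_{1,2}$ are irreducible right $sl_2^1$-modules with $\dim I_{1,1}=\dim I_{1,2}=m+1$; (c) $I=I_{2,1}\oplus I_{2,2}\oplus\dots\oplus I_{2,m+1}$, where each $I_{2,k}$, $1\le k\le m+1$, is an irreducible right $sl_2^2$-module. Then $L$ is isomorphic to the Leibniz algebra with basis $e_1,f_1,h_1,e_2,f_2,h_2$, $x_k^1,x_k^2$ $(0\le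 k\le m)$ and the following multiplication table, where all products of basis elements that are not listed are zero: $$\begin{array}{ll} [e_i,h_i]=-[h_i,e_i]=2e_i, & i=1,2,\\ [e_i,f_i]=-[f_i,e_i]=h_i, & i=1,2,\\ [h_i,f_i]=-[f_i,h_i]=2f_i, & i=1,2,\\ [x_k^i,h_1]=(m-2k)x_k^i, & 0\le k\le m,\ i=1,2,\\ [x_k^i,f_1]=x_{k+1}^i, & 0\le k\le m-1,\ i=1,2,\\ [x_k^i,e_1]=-k(m+1-k)x_{k-1}^i, & 1\le k\le m,\ i=1,2,\\ [x_j^1,e_2]=[x_j^2,h_2]=x_j^2, & 0\le j\le m,\\ [x_j^1,h_2]=[x_j^2,f_2]=-x_j^1, & 0\le j\le m. \end{array}$$ -/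

import Mathlib

/-- A (right) Leibniz ring: an additive group with a biadditive bracket satisfying the (right)
Leibniz identity `[x,[y,z]] = [[x,y],z] - [[x,z],y]`. -/
class LeibnizRing (L : Type*) extends AddCommGroup L, Bracket L L where
  protected add_bracket : ∀ x y z : L, ⁅x + y, z⁆ = ⁅x, z⁆ + ⁅y, z⁆
  protected bracket_add : ∀ x y z : L, ⁅x, y + z⁆ = ⁅x, y⁆ + ⁅x, z⁆
  protected leibniz : ∀ x y z : L, ⁅x, ⁅y, z⁆⁆ = ⁅⁅x, y⁆, z⁆ - ⁅⁅x, z⁆, y⁆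

/-- A (right) Leibniz algebra over `F`: a (right) Leibniz ring with an `F`-vector space structure
for which the bracket is bilinear. -/
class LeibnizAlgebra (F L : Type*) [Field F] [LeibnizRing L] extends Module F L where
  protected smul_bracket : ∀ (c : F) (x y : L), ⁅c • x, y⁆ = c • ⁅x, y⁆
  protected bracket_smul : ∀ (c : F) (x y : L), ⁅x, c • y⁆ = c • ⁅x, y⁆

namespace LeibnizAlgebra

/-- An isomorphism of Leibniz algebras: a linear bijection which preserves the bracket. -/
structure Iso (F L M : Type*) [Field F] [LeibnizRing L] [LeibnizAlgebra F L]
    [LeibnizRing M] [LeibnizAlgebra F M] extends L ≃ₗ[F] M where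
  map_bracket : ∀ x y : L, toLinearEquiv ⁅x, y⁆ = ⁅toLinearEquiv x, toLinearEquiv y⁆

theorem bracket_zero' {L : Type*} [LeibnizRing L] (x : L) : ⁅x, (0 : L)⁆ = 0 := by
  simpa using LeibnizRing.bracket_add x 0 0

theorem zero_bracket' {L : Type*} [LeibnizRing L] (x : L) : ⁅(0 : L), x⁆ = 0 := by
  simpa using LeibnizRing.add_bracket 0 0 x

section Quotient

variable (F L : Type*) [Field F] [LeibnizRing L] [LeibnizAlgebra F L]

/-- The bracket as a bilinear map. -/
def bracketLin : L →ₗ[F] L →ₗ[F] L :=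
  LinearMap.mk₂ F (fun x y => ⁅x, y⁆) LeibnizRing.add_bracket LeibnizAlgebra.smul_bracket
    LeibnizRing.bracket_add LeibnizAlgebra.bracket_smul

variable {F L} in
/-- Two-sided ideals of a Leibniz algebra. -/
def IsIdeal (J : Submodule F L) : Prop :=
  ∀ x ∈ J, ∀ y : L, ⁅x, y⁆ ∈ J ∧ ⁅y, x⁆ ∈ J

/-- The ideal `I` generated by all the squares `[x,x]`: the smallest two-sided ideal which contains
them. -/
def squaresIdeal : Submodule F L :=
  sInf {J : Submodule F L | IsIdeal J ∧ ∀ x : L, ⁅x, x⁆ ∈ J}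

theorem squaresIdeal_isIdeal : IsIdeal (squaresIdeal F L) := by
  intro x hx y
  simp only [squaresIdeal, Submodule.mem_sInf, Set.mem_ofPred_eq] at hx ⊢
  exact ⟨fun J hJ => (hJ.1 x (hx J hJ) y).1, fun J hJ => (hJ.1 x (hx J hJ) y).2⟩

theorem square_mem (x : L) : ⁅x, x⁆ ∈ squaresIdeal F L := by
  simp only [squaresIdeal, Submodule.mem_sInf, Set.mem_ofPred_eq]
  exact fun J hJ => hJ.2 x

/-- Right multiplication by an element of `I` is zero. -/
theorem bracket_eq_zero_of_mem (x : L) {z : L} (hz : z ∈ squaresIdeal F L) : ⁅x, z⁆ = 0 := by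
  let K : Submodule F L :=
    { carrier := {z | ∀ x : L, ⁅x, z⁆ = 0}
      zero_mem' := bracket_zero'
      add_mem' := fun {a b} ha hb x => by
        rw [LeibnizRing.bracket_add, ha x, hb x, add_zero]
      smul_mem' := fun c a ha x => by
        rw [LeibnizAlgebra.bracket_smul, ha x, smul_zero] }
  have hK : K ∈ {J : Submodule F L | IsIdeal J ∧ ∀ x : L, ⁅x, x⁆ ∈ J} := by
    refine ⟨fun a ha y => ⟨fun w => ?_, fun w => ?_⟩, fun y w => ?_⟩
    · rw [LeibnizRing.leibniz, ha w, ha ⁅w, y⁆, zero_bracket', sub_zero]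
    · rw [LeibnizRing.leibniz, ha w, ha ⁅w, y⁆, zero_bracket', sub_zero]
    · rw [LeibnizRing.leibniz, sub_self]
  exact (Submodule.mem_sInf.1 hz K hK) x

/-- The associated Lie algebra `L / I` of a Leibniz algebra. -/
abbrev AssocLie : Type _ := L ⧸ squaresIdeal F L

/-- The right action `L × (L / I) → L`, `(x, a + I) ↦ [x, a]`, which makes `L`, and its ideal `I`,
a right module over the Lie algebra `L / I`. -/
def rightAct : L →ₗ[F] AssocLie F L →ₗ[F] L :=
  ((squaresIdeal F L).liftQ (bracketLin F L).flip (by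
    intro z hz
    rw [LinearMap.mem_ker]
    ext x
    exact bracket_eq_zero_of_mem F L x hz)).flip

@[simp] theorem rightAct_mk (x a : L) :
    rightAct F L x (Submodule.Quotient.mk a) = ⁅x, a⁆ := rfl

/-- The bracket of `L / I`, `[a + I, b + I] = [a, b] + I`. -/
def quotBracket : AssocLie F L →ₗ[F] AssocLie F L →ₗ[F] AssocLie F L :=
  (squaresIdeal F L).liftQ ((rightAct F L).compr₂ (squaresIdeal F L).mkQ) (by
    intro z hz
    rw [LinearMap.mem_ker]
    ext a
    exact (Submodule.Quotient.mk_eq_zero _).2 (squaresIdeal_isIdeal F L z hz a).1)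

instance : Bracket (AssocLie F L) (AssocLie F L) := ⟨fun a b => quotBracket F L a b⟩

@[simp] theorem bracket_mk (a b : L) :
    ⁅(Submodule.Quotient.mk a : AssocLie F L), (Submodule.Quotient.mk b : AssocLie F L)⁆ =
      Submodule.Quotient.mk ⁅a, b⁆ := rfl

instance : LieRing (AssocLie F L) where
  add_lie a b c := by
    change quotBracket F L (a + b) c = quotBracket F L a c + quotBracket F L b c
    simp
  lie_add a b c := by
    change quotBracket F L a (b + c) = quotBracket F L a b + quotBracket F L a c
    simp
  lie_self a := by
    induction a using Submodule.Quotient.induction_on with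
    | H a => exact (Submodule.Quotient.mk_eq_zero _).2 (square_mem F L a)
  leibniz_lie a b c := by
    induction a using Submodule.Quotient.induction_on with
    | H a =>
    induction b using Submodule.Quotient.induction_on with
    | H b =>
    induction c using Submodule.Quotient.induction_on with
    | H c =>
    simp only [bracket_mk]
    rw [← Submodule.Quotient.mk_add, Submodule.Quotient.eq]
    have h1 := LeibnizRing.leibniz a b c
    have h2 : ⁅b, ⁅a, c⁆⁆ + ⁅⁅a, c⁆, b⁆ ∈ squaresIdeal F L := by
      have h := square_mem F L (b + ⁅a, c⁆)
      rw [LeibnizRing.add_bracket, LeibnizRing.bracket_add, LeibnizRing.bracket_add] at h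
      have h' := Submodule.sub_mem _ (Submodule.sub_mem _ h (square_mem F L b))
        (square_mem F L ⁅a, c⁆)
      convert h' using 1
      abel
    rw [h1]
    convert Submodule.neg_mem _ h2 using 1
    abel

instance : LieAlgebra F (AssocLie F L) where
  lie_smul c a b := (quotBracket F L a).map_smul c b

variable {F L}

/-- `N` is a submodule of the right module `L` over the subalgebra `S` of `L / I`. -/
def IsRightSubmodule (S : LieSubalgebra F (AssocLie F L)) (N : Submodule F L) : Prop :=
  ∀ x ∈ N, ∀ a ∈ S, rightAct F L x a ∈ N

/-- `N` is an irreducible right `S`-module: it is a nonzero right `S`-module, whose only submodules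
are zero and `N` itself. -/
def IsIrreducibleRightModule (S : LieSubalgebra F (AssocLie F L)) (N : Submodule F L) : Prop :=
  IsRightSubmodule S N ∧ N ≠ ⊥ ∧
    ∀ N' : Submodule F L, N' ≤ N → IsRightSubmodule S N' → N' = ⊥ ∨ N' = N

/-- The space `J` is the (internal) direct sum of the family of subspaces `N`. -/
def IsDirectSumOf {ι : Type*} (J : Submodule F L) (N : ι → Submodule F L) : Prop :=
  iSupIndep N ∧ ⨆ i, N i = J

end Quotient

/-- The Lie algebra `sl_2` over `ℂ` (traceless `2 × 2` matrices); up to isomorphism this is the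
only three-dimensional simple complex Lie algebra. -/
abbrev Sl2 : Type := LieAlgebra.SpecialLinear.sl (Fin 2) ℂ

section Copies

variable {L : Type*} [LeibnizRing L] [LeibnizAlgebra ℂ L]

/-- The first summand `sl_2^1` of `L / I ≅ sl_2^1 ⊕ sl_2^2`. -/
noncomputable def firstCopy (ψ : AssocLie ℂ L ≃ₗ⁅ℂ⁆ (Sl2 × Sl2)) : LieSubalgebra ℂ (AssocLie ℂ L) :=
  (ψ.symm.toLieHom.comp (LieHom.inl ℂ Sl2 Sl2)).range

/-- The second summand `sl_2^2` of `L / I ≅ sl_2^1 ⊕ sl_2^2`. -/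
noncomputable def secondCopy (ψ : AssocLie ℂ L ≃ₗ⁅ℂ⁆ (Sl2 × Sl2)) : LieSubalgebra ℂ (AssocLie ℂ L) :=
  (ψ.symm.toLieHom.comp (LieHom.inr ℂ Sl2 Sl2)).range

end Copies

/-! ### The explicit algebra -/

/-- Indices of the basis `e_i, f_i, h_i, x_k^i` (`i = 1, 2`, `0 ≤ k ≤ m`) of the explicit algebra;
the elements `0, 1` of `Fin 2` stand for the indices `i = 1, 2`. -/
inductive BasisIndex (m : ℕ) : Type
  | e (i : Fin 2)
  | f (i : Fin 2)
  | h (i : Fin 2)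
  | x (i : Fin 2) (k : Fin (m + 1))

/-- The complex vector space with basis `e_i, f_i, h_i, x_k^i`. -/
def ExplicitAlgebra (m : ℕ) : Type := BasisIndex m →₀ ℂ

namespace ExplicitAlgebra

variable {m : ℕ}

noncomputable instance : AddCommGroup (ExplicitAlgebra m) :=
  inferInstanceAs (AddCommGroup (BasisIndex m →₀ ℂ))

noncomputable instance : Module ℂ (ExplicitAlgebra m) :=
  inferInstanceAs (Module ℂ (BasisIndex m →₀ ℂ))

/-- The basis `e_i, f_i, h_i, x_k^i`. -/
noncomputable def basis (m : ℕ) : Module.Basis (BasisIndex m) ℂ (ExplicitAlgebra m) :=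
  Module.Basis.ofRepr (LinearEquiv.refl ℂ (BasisIndex m →₀ ℂ))

/-- The basis vectors `e_i` of the explicit algebra. -/
noncomputable def ve (i : Fin 2) : ExplicitAlgebra m := basis m (.e i)

/-- The basis vectors `f_i` of the explicit algebra. -/
noncomputable def vf (i : Fin 2) : ExplicitAlgebra m := basis m (.f i)

/-- The basis vectors `h_i` of the explicit algebra. -/
noncomputable def vh (i : Fin 2) : ExplicitAlgebra m := basis m (.h i)

/-- The basis vectors `x_k^i` for `k ≤ m`, and zero for `k > m`. -/
noncomputable def vx (i : Fin 2) (k : ℕ) : ExplicitAlgebra m :=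
  if hk : k < m + 1 then basis m (.x i ⟨k, hk⟩) else 0

/-- The multiplication table on basis vectors. -/
noncomputable def table : BasisIndex m → BasisIndex m → ExplicitAlgebra m
  -- `[e_i,h_i] = -[h_i,e_i] = 2 e_i`
  | .e i, .h j => if i = j then (2 : ℂ) • ve i else 0
  | .h i, .e j => if i = j then -((2 : ℂ) • ve i) else 0
  -- `[e_i,f_i] = -[f_i,e_i] = h_i`
  | .e i, .f j => if i = j then vh i else 0
  | .f i, .e j => if i = j then -vh i else 0
  -- `[h_i,f_i] = -[f_i,h_i] = 2 f_i`
  | .h i, .f j => if i = j then (2 : ℂ) • vf i else 0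
  | .f i, .h j => if i = j then -((2 : ℂ) • vf i) else 0
  -- `[x_k^i,h_1] = (m - 2k) x_k^i`
  | .x i k, .h 0 => ((m : ℂ) - 2 * (k : ℕ)) • vx i k
  -- `[x_k^i,f_1] = x_{k+1}^i` for `k ≤ m - 1`, and `[x_m^i,f_1] = 0`
  | .x i k, .f 0 => vx i (k + 1)
  -- `[x_k^i,e_1] = -k (m + 1 - k) x_{k-1}^i` for `1 ≤ k`, and `[x_0^i,e_1] = 0`
  | .x i k, .e 0 => (-((k : ℕ) * ((m : ℂ) + 1 - (k : ℕ)))) • vx i (k - 1)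
  -- `[x_j^1,e_2] = [x_j^2,h_2] = x_j^2`
  | .x 0 j, .e 1 => vx 1 j
  | .x 1 j, .h 1 => vx 1 j
  -- `[x_j^1,h_2] = [x_j^2,f_2] = -x_j^1`
  | .x 0 j, .h 1 => -vx 0 j
  | .x 1 j, .f 1 => -vx 0 j
  -- all other products vanish
  | _, _ => 0

/-- The product of the explicit algebra: the bilinear extension of the multiplication table. -/
noncomputable def mul (m : ℕ) :
    ExplicitAlgebra m →ₗ[ℂ] ExplicitAlgebra m →ₗ[ℂ] ExplicitAlgebra m :=
  (basis m).constr ℂ fun a => (basis m).constr ℂ fun b => table a b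

theorem mul_basis (a b : BasisIndex m) : mul m (basis m a) (basis m b) = table a b := by
  simp [mul]

theorem basis_x (i : Fin 2) (k : Fin (m + 1)) : basis m (.x i k) = vx i k := by
  rw [vx, dif_pos k.2]

theorem mul_vx (i : Fin 2) (k : ℕ) (b : BasisIndex m) (hk : k < m + 1) :
    mul m (vx i k) (basis m b) = table (.x i ⟨k, hk⟩) b := by
  rw [vx, dif_pos hk, mul_basis]

theorem mul_vx_of_not (i : Fin 2) (k : ℕ) (b : BasisIndex m) (hk : ¬ k < m + 1) :
    mul m (vx i k) (basis m b) = 0 := by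
  rw [vx, dif_neg hk]; simp

theorem mul_vx_h0 (i : Fin 2) (k : ℕ) :
    mul m (vx i k) (vh 0) = ((m : ℂ) - 2 * k) • vx i k := by
  by_cases hk : k < m + 1
  · rw [vh, mul_vx _ _ _ hk]; rfl
  · rw [vh, mul_vx_of_not _ _ _ hk, vx, dif_neg hk, smul_zero]

theorem mul_vx_f0 (i : Fin 2) (k : ℕ) :
    mul m (vx i k) (vf 0) = vx i (k + 1) := by
  by_cases hk : k < m + 1
  · rw [vf, mul_vx _ _ _ hk]; rfl
  · rw [vf, mul_vx_of_not _ _ _ hk, vx, dif_neg (by omega)]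

theorem mul_vx_e0 (i : Fin 2) (k : ℕ) (hk : k ≤ m + 1) :
    mul m (vx i k) (ve 0) = (-(k * ((m : ℂ) + 1 - k))) • vx i (k - 1) := by
  by_cases hk' : k < m + 1
  · rw [ve, mul_vx _ _ _ hk']; rfl
  · obtain rfl : k = m + 1 := by omega
    rw [ve, mul_vx_of_not _ _ _ hk']; simp

theorem mul_vx_1 (k : ℕ) :
    mul m (vx 0 k) (ve 1) = vx 1 k ∧ mul m (vx 1 k) (ve 1) = 0 ∧
    mul m (vx 0 k) (vh 1) = -vx 0 k ∧ mul m (vx 1 k) (vh 1) = vx 1 k ∧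
    mul m (vx 0 k) (vf 1) = 0 ∧ mul m (vx 1 k) (vf 1) = -vx 0 k := by
  by_cases hk : k < m + 1
  · simp only [ve, vf, vh, mul_vx _ _ _ hk]
    exact ⟨rfl, rfl, rfl, rfl, rfl, rfl⟩
  · simp only [ve, vf, vh, mul_vx_of_not _ _ _ hk]
    simp only [vx, dif_neg hk, neg_zero, and_self]

theorem mul_vx_right (v : ExplicitAlgebra m) (i : Fin 2) (k : ℕ) : mul m v (vx i k) = 0 := by
  by_cases hk : k < m + 1
  · have : (mul m).flip (basis m (.x i ⟨k, hk⟩)) = 0 := by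
      refine (basis m).ext fun a => ?_
      rw [LinearMap.flip_apply, mul_basis]
      cases a <;> rfl
    rw [vx, dif_pos hk]
    exact LinearMap.congr_fun this v
  · rw [vx, dif_neg hk]; simp

set_option maxHeartbeats 2000000 in
theorem leibniz_vx (i : Fin 2) (k : ℕ) (hk : k < m + 1) (b c : BasisIndex m) :
    mul m (vx i k) (mul m (basis m b) (basis m c)) =
      mul m (mul m (vx i k) (basis m b)) (basis m c) -
        mul m (mul m (vx i k) (basis m c)) (basis m b) := by
  have be (j) : basis m (.e j) = ve j := rfl
  have bf (j) : basis m (.f j) = vf j := rfl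
  have bh (j) : basis m (.h j) = vh j := rfl
  have e1 (i) := mul_vx_e0 (m := m) i (k + 1) (by omega)
  have A1 (k) := (mul_vx_1 (m := m) k).1
  have A2 (k) := (mul_vx_1 (m := m) k).2.1
  have A3 (k) := (mul_vx_1 (m := m) k).2.2.1
  have A4 (k) := (mul_vx_1 (m := m) k).2.2.2.1
  have A5 (k) := (mul_vx_1 (m := m) k).2.2.2.2.1
  have A6 (k) := (mul_vx_1 (m := m) k).2.2.2.2.2
  rw [mul_basis]
  have e0 (i) := mul_vx_e0 (m := m) i k (by omega)
  rcases Nat.eq_zero_or_pos k with rfl | h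
  · rcases b with j | j | j | ⟨j, l⟩ <;> rcases c with j' | j' | j' | ⟨j', l'⟩ <;>
      (try fin_cases j) <;> (try fin_cases j') <;>
      (try fin_cases i) <;>
      simp [table, basis_x, be, bf, bh, mul_vx_right, e0, e1, A1, A2, A3, A4, A5, A6, mul_vx_h0,
        mul_vx_f0]
    all_goals module
  · obtain ⟨k, rfl⟩ : ∃ n, k = n + 1 := ⟨k - 1, by omega⟩
    have e2 (i) := mul_vx_e0 (m := m) i k (by omega)
    rcases b with j | j | j | ⟨j, l⟩ <;> rcases c with j' | j' | j' | ⟨j', l'⟩ <;>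
      (try fin_cases j) <;> (try fin_cases j') <;>
      (try fin_cases i) <;>
      simp [table, basis_x, be, bf, bh, mul_vx_right, e0, e1, e2, A1, A2, A3, A4, A5, A6,
        mul_vx_h0, mul_vx_f0]
    all_goals module

theorem table_x_mem (a : BasisIndex m) (j : Fin 2) (l : Fin (m + 1)) (v : ExplicitAlgebra m) :
    mul m v (table (.x j l) a) = 0 := by
  rcases a with i | i | i | ⟨i, k⟩ <;> (try fin_cases i) <;> fin_cases j <;>
    simp [table, mul_vx_right]

set_option maxHeartbeats 2000000 in
theorem leibniz_basis (a b c : BasisIndex m) :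
    mul m (basis m a) (mul m (basis m b) (basis m c)) =
      mul m (mul m (basis m a) (basis m b)) (basis m c) -
        mul m (mul m (basis m a) (basis m c)) (basis m b) := by
  rcases c with k | k | k | ⟨k, n⟩
  case x => simp [basis_x, mul_vx_right]
  all_goals
    rcases b with j | j | j | ⟨j, l⟩
    case x => rw [mul_basis, table_x_mem, basis_x]; simp [mul_vx_right]
    all_goals
      rcases a with i | i | i | ⟨i, p⟩
      case x => rw [basis_x]; exact leibniz_vx i p p.2 _ _
      all_goals
        simp only [mul_basis, table]
        (try split_ifs) <;> subst_vars <;>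
          simp_all [ve, vf, vh, mul_basis, table]
  all_goals first | module | (intro h; subst h; simp_all)

theorem mul_leibniz (x y z : ExplicitAlgebra m) :
    mul m x (mul m y z) = mul m (mul m x y) z - mul m (mul m x z) y := by
  have h1 (a b : BasisIndex m) (z : ExplicitAlgebra m) :=
    LinearMap.congr_fun (show mul m (basis m a) ∘ₗ mul m (basis m b) =
      mul m (mul m (basis m a) (basis m b)) -
        (mul m).flip (basis m b) ∘ₗ mul m (basis m a) from
      (basis m).ext fun c => leibniz_basis a b c) z
  have h2 (a : BasisIndex m) (y z : ExplicitAlgebra m) :=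
    LinearMap.congr_fun (show mul m (basis m a) ∘ₗ (mul m).flip z =
      (mul m).flip z ∘ₗ mul m (basis m a) - mul m (mul m (basis m a) z) from
      (basis m).ext fun b => h1 a b z) y
  exact LinearMap.congr_fun (show (mul m).flip (mul m y z) =
    (mul m).flip z ∘ₗ (mul m).flip y - (mul m).flip y ∘ₗ (mul m).flip z from
    (basis m).ext fun a => h2 a y z) x

noncomputable instance : LeibnizRing (ExplicitAlgebra m) where
  bracket x y := mul m x y
  add_bracket x y z := by
    change mul m (x + y) z = mul m x z + mul m y z
    simp
  bracket_add x y z := (mul m x).map_add y z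
  leibniz := mul_leibniz

noncomputable instance : LeibnizAlgebra ℂ (ExplicitAlgebra m) where
  smul_bracket c x y := by
    change mul m (c • x) y = c • mul m x y
    simp
  bracket_smul c x y := (mul m x).map_smul c y

theorem bracket_basis (a b : BasisIndex m) : ⁅basis m a, basis m b⁆ = table a b := mul_basis a b

end ExplicitAlgebra

end LeibnizAlgebra

-- With the sign change `a · x = -[x, a]` the right action becomes a left action of `sl₂ ⊕ sl₂` on
-- all of `L`. It preserves `I`, and the projection of `L` onto `L / I` is equivariant for the
-- adjoint action. So `L` carries two commuting `sl₂`-triples, and two facts have to be shown.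
--
-- Structure of `I` (`exists_highest_weight_vector`). By (b), `dim I = 2(m + 1)`, so one of the `m +
-- 1` summands in (c) has dimension at least 2 and contains a primitive vector of some weight `n ≥
-- 1` for the second triple. The vectors of `I` that are primitive of that weight for the second
-- triple, together with 0, form a space stable under the first triple. It therefore contains a
-- vector `v` primitive for both, and (b) forces its first weight to be `m`. The `(n + 1)(m + 1)`
-- vectors obtained from `v` by the two lowering operators are independent, so `n = 1` and they form
-- a basis of `I`.
--
-- Splitting of `L → L / I` (`exists_section`). No general Levi theorem is needed. The Casimir
-- operator `C` of the second triple is 3 on `I`, and on `L / I` it is 0 on the first factor and 8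
-- on the second. Hence `C(C - 8)` commutes with the action, is -15 on `I` and maps `L` into `I`;
-- its kernel is a complement of `I` closed under the bracket.
--
-- A basis of `sl₂ ⊕ sl₂`, lifted to this kernel, and the strings over `v` then satisfy the required
-- table, after adjusting signs.

attribute [local instance] LieRing.ofAssociativeRing

theorem Submodule.finrank_iSup_le_sum {K V ι : Type*} [Field K] [AddCommGroup V] [Module K V]
    [FiniteDimensional K V] [Fintype ι] (W : ι → Submodule K V) :
    Module.finrank K (⨆ i, W i : Submodule K V) ≤ ∑ i, Module.finrank K (W i) := by
  classical
  rw [← Finset.sup_univ_eq_iSup]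
  induction (Finset.univ : Finset ι) using Finset.induction_on with
  | empty => simp
  | insert i s hi ih =>
    rw [Finset.sup_insert, Finset.sum_insert hi]
    exact (Submodule.finrank_add_le_finrank_add_finrank _ _).trans (Nat.add_le_add_left ih _)

/-! ### One `sl₂`-triple of operators: strings, irreducible subspaces, the Casimir operator. -/

namespace IsSl2Triple

open Module

variable {V : Type*} [AddCommGroup V] [Module ℂ V]
  {h e f : Module.End ℂ V}

theorem h_pow_f_apply (t : IsSl2Triple h e f) {v : V} {n : ℂ}
    (hv : t.HasPrimitiveVectorWith v n) (k : ℕ) :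
    h ((f ^ k) v) = (n - 2 * k) • (f ^ k) v := by
  simpa using hv.lie_h_pow_toEnd_f k

theorem e_pow_succ_f_apply (t : IsSl2Triple h e f) {v : V} {n : ℂ}
    (hv : t.HasPrimitiveVectorWith v n) (k : ℕ) :
    e ((f ^ (k + 1)) v) = ((k + 1) * (n - k)) • (f ^ k) v := by
  simpa only [LieModule.toEnd_module_end, LieHom.coe_id, id, LieHom.id_apply,
    Module.End.lie_apply] using hv.lie_e_pow_succ_toEnd_f k

theorem pow_f_apply_eq_zero [FiniteDimensional ℂ V] (t : IsSl2Triple h e f) {v : V} {n : ℕ}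
    (hv : t.HasPrimitiveVectorWith v (n : ℂ)) {k : ℕ} (hk : n < k) : (f ^ k) v = 0 := by
  obtain ⟨j, rfl⟩ : ∃ j, k = j + (n + 1) := ⟨k - (n + 1), by omega⟩
  have := hv.pow_toEnd_f_eq_zero_of_eq_nat rfl
  simp only [LieModule.toEnd_module_end, LieHom.id_apply] at this
  rw [pow_add, Module.End.mul_apply, this, map_zero]

theorem pow_f_apply_ne_zero (t : IsSl2Triple h e f) {v : V} {n : ℕ}
    (hv : t.HasPrimitiveVectorWith v (n : ℂ)) {k : ℕ} (hk : k ≤ n) : (f ^ k) v ≠ 0 := by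
  simpa using hv.pow_toEnd_f_ne_zero_of_eq_nat rfl hk

theorem linearIndependent_pow_f (t : IsSl2Triple h e f) {v : V} {n : ℕ}
    (hv : t.HasPrimitiveVectorWith v (n : ℂ)) :
    LinearIndependent ℂ fun k : Fin (n + 1) => (f ^ (k : ℕ)) v := by
  refine Module.End.eigenvectors_linearIndependent' h (fun k : Fin (n + 1) => (n : ℂ) - 2 * (k : ℕ))
    (fun a b hab => ?_) _ fun k => ⟨Module.End.mem_eigenspace_iff.2 (t.h_pow_f_apply hv k),
      t.pow_f_apply_ne_zero hv (by omega)⟩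
  simpa [Fin.ext_iff] using hab

/-- `W` is stable under the three operators of an `sl₂`-triple. -/
def Stabilizes (_ : IsSl2Triple h e f) (W : Submodule ℂ V) : Prop :=
  ∀ x ∈ W, h x ∈ W ∧ e x ∈ W ∧ f x ∈ W

/-- `W` has no proper nonzero subspace stable under the `sl₂`-triple. -/
def ActsIrreducibly (t : IsSl2Triple h e f) (W : Submodule ℂ V) : Prop :=
  t.Stabilizes W ∧ W ≠ ⊥ ∧ ∀ N ≤ W, t.Stabilizes N → N = ⊥ ∨ N = W

theorem Stabilizes.pow_f_mem {t : IsSl2Triple h e f} {W : Submodule ℂ V} (hW : t.Stabilizes W)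
    {x : V} (hx : x ∈ W) (k : ℕ) : (f ^ k) x ∈ W := by
  induction k with
  | zero => simpa
  | succ k ih => rw [pow_succ', Module.End.mul_apply]; exact (hW _ ih).2.2

/-- Start from an eigenvector `w` of `h` in `W`. The vectors `e ^ k w` have distinct eigenvalues `μ
+ 2k`, so in finite dimension some of them vanish, and the last one before the first zero is
primitive. Its weight is a natural number, again by finite dimension. -/
theorem Stabilizes.exists_hasPrimitiveVectorWith [FiniteDimensional ℂ V]
    {t : IsSl2Triple h e f} {W : Submodule ℂ V}
    (hW : t.Stabilizes W) (hW0 : W ≠ ⊥) :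
    ∃ v ∈ W, ∃ n : ℕ, t.HasPrimitiveVectorWith v (n : ℂ) := by
  have : Nontrivial W := Submodule.nontrivial_iff_ne_bot.2 hW0
  obtain ⟨μ, hμ⟩ := Module.End.exists_eigenvalue (h.restrict fun x hx => (hW x hx).1)
  obtain ⟨w, hw⟩ := hμ.exists_hasEigenvector
  have hw0 : (w : V) ≠ 0 := by simpa using hw.2
  have hwh : h w = μ • (w : V) := congrArg Subtype.val hw.apply_eq_smul
  have hpow (k : ℕ) : h ((e ^ k) w) = (μ + 2 * k) • (e ^ k) (w : V) := by
    simpa using t.lie_h_pow_toEnd_e (m := (w : V)) hwh k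
  have hmem (k : ℕ) : (e ^ k) (w : V) ∈ W := by
    induction k with
    | zero => simp
    | succ k ih => rw [pow_succ', Module.End.mul_apply]; exact (hW _ ih).2.1
  have hzero : ∃ k, (e ^ k) (w : V) = 0 := by
    by_contra! hne
    have := (Module.End.eigenvectors_linearIndependent' h (fun k : ℕ => μ + 2 * (k : ℂ))
      (fun a b hab => by simpa using hab) _
      fun k => ⟨Module.End.mem_eigenspace_iff.2 (hpow k), hne k⟩).finite
    exact not_finite ℕ
  obtain ⟨k, hk, hk'⟩ := Nat.exists_not_and_succ_of_not_zero_of_exists (by simpa using hw0) hzero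
  have hv : t.HasPrimitiveVectorWith ((e ^ k) (w : V)) (μ + 2 * k) :=
    ⟨hk, hpow k, by rwa [pow_succ', Module.End.mul_apply] at hk'⟩
  obtain ⟨n, hn⟩ := hv.exists_nat
  exact ⟨_, hmem k, n, hn ▸ hv⟩

/-- The string `v, f v, …, f ^ n v` is independent and spans a nonzero stable subspace of `W`, which
irreducibility makes all of `W`. -/
theorem ActsIrreducibly.finrank_eq [FiniteDimensional ℂ V]
    {t : IsSl2Triple h e f} {W : Submodule ℂ V}
    (hW : t.ActsIrreducibly W) {v : V} (hvW : v ∈ W) {n : ℕ}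
    (hv : t.HasPrimitiveVectorWith v (n : ℂ)) : finrank ℂ W = n + 1 := by
  set N := Submodule.span ℂ (Set.range fun k : Fin (n + 1) => (f ^ (k : ℕ)) v) with hN
  have hpow (k : ℕ) : (f ^ k) v ∈ N := by
    rcases le_or_gt k n with hk | hk
    · exact Submodule.subset_span ⟨⟨k, by omega⟩, rfl⟩
    · rw [t.pow_f_apply_eq_zero hv hk]; exact N.zero_mem
  have hle : N ≤ W := by
    rw [hN, Submodule.span_le]
    rintro _ ⟨k, rfl⟩
    exact hW.1.pow_f_mem hvW k
  have key (g : Module.End ℂ V) (hg : ∀ k : ℕ, g ((f ^ k) v) ∈ N) : ∀ x ∈ N, g x ∈ N := by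
    change N ≤ N.comap g
    conv_lhs => rw [hN]
    rw [Submodule.span_le]
    rintro _ ⟨k, rfl⟩
    exact hg k
  have hst : t.Stabilizes N := fun x hx => by
    refine ⟨key h (fun k => ?_) x hx, key e (fun k => ?_) x hx, key f (fun k => ?_) x hx⟩
    · rw [t.h_pow_f_apply hv]; exact N.smul_mem _ (hpow k)
    · cases k with
      | zero => simpa using (show e v = 0 from hv.lie_e) ▸ N.zero_mem
      | succ k => rw [t.e_pow_succ_f_apply hv]; exact N.smul_mem _ (hpow k)
    · rw [← Module.End.mul_apply, ← pow_succ']; exact hpow _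
  rcases hW.2.2 N hle hst with h0 | h1
  · have := hpow 0
    rw [h0] at this
    exact absurd (by simpa using this) hv.ne_zero
  · rw [← h1, hN, finrank_span_eq_card (t.linearIndependent_pow_f hv), Fintype.card_fin]

/-- If `J` is the direct sum of two irreducible spaces of dimension `m + 1`, every primitive vector
in `J` has weight `m`. -/
theorem weight_eq_of_mem_sup [FiniteDimensional ℂ V] {t : IsSl2Triple h e f} {W₀ W₁ : Submodule ℂ V}
    (h₀ : t.ActsIrreducibly W₀) (h₁ : t.ActsIrreducibly W₁) (hd : Disjoint W₀ W₁) {m : ℕ}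
    (d₀ : finrank ℂ W₀ = m + 1) (d₁ : finrank ℂ W₁ = m + 1) {v : V} (hvJ : v ∈ W₀ ⊔ W₁) {n : ℕ}
    (hv : t.HasPrimitiveVectorWith v (n : ℂ)) : n = m := by
  obtain ⟨a, ha, b, hb, rfl⟩ := Submodule.mem_sup.1 hvJ
  have split {x y : V} (hx : x ∈ W₀) (hy : y ∈ W₁) (hxy : x + y = 0) : x = 0 ∧ y = 0 := by
    have hx0 : x = 0 := Submodule.disjoint_def.1 hd x hx <| by
      rw [eq_neg_of_add_eq_zero_left hxy]; exact W₁.neg_mem hy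
    exact ⟨hx0, by simpa [hx0] using hxy⟩
  -- Both summands are stable, so each component of `v` is killed by `e` and scaled by `n` under
  -- `h`. A nonzero component is thus primitive of weight `n`, and the dimension of its summand
  -- gives `n + 1 = m + 1`.
  have hE := split (h₀.1 a ha).2.1 (h₁.1 b hb).2.1 (by rw [← map_add]; exact hv.lie_e)
  have hH := split (W₀.sub_mem (h₀.1 a ha).1 (W₀.smul_mem (n : ℂ) ha))
    (W₁.sub_mem (h₁.1 b hb).1 (W₁.smul_mem (n : ℂ) hb)) (by
      have : h (a + b) = (n : ℂ) • (a + b) := hv.lie_h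
      rw [map_add, smul_add] at this
      rw [sub_add_sub_comm, this, sub_self])
  by_cases ha0 : a = 0
  · have hb0 : b ≠ 0 := fun hb0 => hv.ne_zero (by rw [ha0, hb0, add_zero])
    have := h₁.finrank_eq hb (n := n) ⟨hb0, sub_eq_zero.1 hH.2, hE.2⟩
    omega
  · have := h₀.finrank_eq ha (n := n) ⟨ha0, sub_eq_zero.1 hH.1, hE.1⟩
    omega

theorem Stabilizes.iSup {t : IsSl2Triple h e f} {ι : Type*} {W : ι → Submodule ℂ V}
    (hW : ∀ i, t.Stabilizes (W i)) : t.Stabilizes (⨆ i, W i) := by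
  have key (g : Module.End ℂ V) (hg : ∀ i, ∀ x ∈ W i, g x ∈ W i) :
      ∀ x ∈ ⨆ i, W i, g x ∈ ⨆ i, W i := by
    change ⨆ i, W i ≤ (⨆ i, W i).comap g
    exact iSup_le fun i x hx => Submodule.mem_iSup_of_mem i (hg i x hx)
  exact fun x hx => ⟨key h (fun i x hx => (hW i x hx).1) x hx,
    key e (fun i x hx => (hW i x hx).2.1) x hx, key f (fun i x hx => (hW i x hx).2.2) x hx⟩

/-- The Casimir operator `h² + 2h + 4fe`. -/
def casimir (_ : IsSl2Triple h e f) : Module.End ℂ V := h * h + (2 : ℂ) • h + (4 : ℂ) • (f * e)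

theorem commute_casimir_of_commute (t : IsSl2Triple h e f) {g : Module.End ℂ V} (hh : Commute g h)
    (he : Commute g e) (hf : Commute g f) : Commute g t.casimir :=
  ((hh.mul_right hh).add_right (hh.smul_right _)).add_right ((hf.mul_right he).smul_right _)

theorem commute_casimir (t : IsSl2Triple h e f) :
    Commute h t.casimir ∧ Commute e t.casimir ∧ Commute f t.casimir := by
  have hhe : h * e = e * h + (2 : ℂ) • e := by
    rw [← t.lie_h_e_smul ℂ, LieRing.of_associative_ring_bracket]; abel
  have hhf : h * f = f * h - (2 : ℂ) • f := by
    rw [sub_eq_add_neg, ← t.lie_lie_smul_f ℂ, LieRing.of_associative_ring_bracket]; abel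
  have hef : e * f = f * e + h := by
    conv_rhs => rw [← t.lie_e_f]
    rw [LieRing.of_associative_ring_bracket]; abel
  refine ⟨?_, ?_, ?_⟩
  · have h1 : h * (f * e) = f * e * h := by
      rw [← mul_assoc, hhf, sub_mul, mul_assoc, hhe, mul_add, smul_mul_assoc, mul_smul_comm,
        mul_assoc]
      abel
    exact ((((Commute.refl h).mul_right (Commute.refl h)).add_right
      ((Commute.refl h).smul_right _)).add_right (Commute.smul_right h1 _))
  · have h1 : h * h * e = e * h * h + (4 : ℂ) • (e * h) + (4 : ℂ) • e := by
      rw [mul_assoc, hhe, mul_add, ← mul_assoc, hhe, mul_smul_comm, hhe, add_mul, smul_mul_assoc]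
      module
    have h2 : e * (f * e) = f * e * e + e * h + (2 : ℂ) • e := by
      rw [← mul_assoc, hef, add_mul, hhe, add_assoc]
    rw [commute_iff_eq, casimir, mul_add, mul_add, add_mul, add_mul, h1]
    simp only [mul_smul_comm, smul_mul_assoc, h2, hhe, ← mul_assoc]
    module
  · have h1 : h * h * f = f * h * h - (4 : ℂ) • (f * h) + (4 : ℂ) • f := by
      rw [mul_assoc, hhf, mul_sub, ← mul_assoc, hhf, mul_smul_comm, hhf, sub_mul, smul_mul_assoc]
      module
    have h2 : f * e * f = f * (f * e) + f * h := by
      rw [mul_assoc, hef, mul_add]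
    rw [commute_iff_eq, casimir, mul_add, mul_add, add_mul, add_mul, h1]
    simp only [mul_smul_comm, smul_mul_assoc, h2, hhf, ← mul_assoc]
    module

/-- On a primitive vector the term `4fe` vanishes and only `h² + 2h` remains. -/
theorem casimir_apply (t : IsSl2Triple h e f) {v : V} {n : ℂ}
    (hv : t.HasPrimitiveVectorWith v n) : t.casimir v = (n * (n + 2)) • v := by
  have hh : h v = n • v := hv.lie_h
  have he : e v = 0 := hv.lie_e
  simp only [casimir, LinearMap.add_apply, LinearMap.smul_apply, Module.End.mul_apply, hh, he,
    map_smul, map_zero]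
  module

/-! ### Two commuting `sl₂`-triples. -/

section Commuting

variable {h' e' f' : Module.End ℂ V}

theorem HasPrimitiveVectorWith.map_of_commute {t : IsSl2Triple h e f} {v : V} {n : ℂ}
    (hv : t.HasPrimitiveVectorWith v n) {g : Module.End ℂ V} (hh : Commute g h)
    (he : Commute g e) (hg : g v ≠ 0) : t.HasPrimitiveVectorWith (g v) n := by
  have h1 : h v = n • v := hv.lie_h
  have h2 : e v = 0 := hv.lie_e
  refine ⟨hg, ?_, ?_⟩
  · change (h * g) v = _
    rw [← hh.eq, Module.End.mul_apply, h1, map_smul]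
  · change (e * g) v = _
    rw [← he.eq, Module.End.mul_apply, h2, map_zero]

/-- The single operator `h + (m + 1) h'` separates these vectors: the eigenvalue at `(i, k)` is a
constant minus twice `k + (m + 1) i`, and `0 ≤ k ≤ m` is a digit in base `m + 1`. -/
theorem linearIndependent_pow_pow (t : IsSl2Triple h e f) (t' : IsSl2Triple h' e' f')
    (hf'h : Commute f' h) (hf'e : Commute f' e) (hfh' : Commute f h')
    {v : V} {m n : ℕ} (hv : t.HasPrimitiveVectorWith v (m : ℂ))
    (hv' : t'.HasPrimitiveVectorWith v (n : ℂ)) :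
    LinearIndependent ℂ fun p : Fin (n + 1) × Fin (m + 1) =>
      (f ^ (p.2 : ℕ)) ((f' ^ (p.1 : ℕ)) v) := by
  have hprim (i : Fin (n + 1)) : t.HasPrimitiveVectorWith ((f' ^ (i : ℕ)) v) (m : ℂ) :=
    hv.map_of_commute (hf'h.pow_left _) (hf'e.pow_left _)
      (t'.pow_f_apply_ne_zero hv' (by omega))
  refine Module.End.eigenvectors_linearIndependent' (h + ((m : ℂ) + 1) • h')
    (fun p => (m : ℂ) - 2 * (p.2 : ℕ) + (m + 1) * (n - 2 * (p.1 : ℕ)))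
    (fun a b hab => ?_) _ fun p => ⟨Module.End.mem_eigenspace_iff.2 ?_,
      t.pow_f_apply_ne_zero (hprim p.1) (by omega)⟩
  · apply finProdFinEquiv.injective
    rw [Fin.ext_iff, finProdFinEquiv_apply_val, finProdFinEquiv_apply_val,
      ← Nat.cast_inj (R := ℂ)]
    push_cast
    linear_combination (-1 / 2 : ℂ) * hab
  · have h1 : h' ((f ^ (p.2 : ℕ)) ((f' ^ (p.1 : ℕ)) v)) =
        ((n : ℂ) - 2 * (p.1 : ℕ)) • (f ^ (p.2 : ℕ)) ((f' ^ (p.1 : ℕ)) v) := by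
      rw [← Module.End.mul_apply, ← (hfh'.pow_left _).eq, Module.End.mul_apply,
        t'.h_pow_f_apply hv', map_smul]
    rw [LinearMap.add_apply, LinearMap.smul_apply, t.h_pow_f_apply (hprim p.1), h1]
    module

/-- Two commuting `sl₂`-triples acting on `J`: if `J` is the direct sum of two irreducible spaces of
dimension `m + 1` for the first one, and of `m + 1` irreducible spaces for the second one, then
there is a vector of highest weight `(m, 1)`, and it generates `J`. -/
theorem exists_highest_weight_vector [FiniteDimensional ℂ V]
    (t : IsSl2Triple h e f) (t' : IsSl2Triple h' e' f')
    (hc : ∀ g ∈ ({h, e, f} : Set (Module.End ℂ V)), Commute g h' ∧ Commute g e' ∧ Commute g f')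
    {J W₀ W₁ : Submodule ℂ V} {m : ℕ} (h₀ : t.ActsIrreducibly W₀) (h₁ : t.ActsIrreducibly W₁)
    (hd : Disjoint W₀ W₁) (hJ : W₀ ⊔ W₁ = J) (d₀ : finrank ℂ W₀ = m + 1)
    (d₁ : finrank ℂ W₁ = m + 1) {W' : Fin (m + 1) → Submodule ℂ V}
    (hW' : ∀ k, t'.ActsIrreducibly (W' k)) (hJ' : ⨆ k, W' k = J) :
    ∃ v, t.HasPrimitiveVectorWith v (m : ℂ) ∧ t'.HasPrimitiveVectorWith v ((1 : ℕ) : ℂ) ∧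
      J = Submodule.span ℂ (Set.range fun p : Fin (1 + 1) × Fin (m + 1) =>
        (f ^ (p.2 : ℕ)) ((f' ^ (p.1 : ℕ)) v)) := by
  have hh := hc h (by simp)
  have he := hc e (by simp)
  have hf := hc f (by simp)
  have hdim : finrank ℂ J = 2 * (m + 1) := by
    have := Submodule.finrank_sup_add_finrank_inf_eq W₀ W₁
    rw [hd.eq_bot, finrank_bot, hJ] at this
    omega
  have hstJ : t.Stabilizes J := by
    have := Stabilizes.iSup (t := t) (W := fun b : Bool => cond b W₀ W₁)
      (by rintro (_ | _); exacts [h₁.1, h₀.1])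
    rwa [iSup_bool_eq, cond_true, cond_false, hJ] at this
  have hst'J : t'.Stabilizes J := hJ' ▸ Stabilizes.iSup fun k => (hW' k).1
  -- Otherwise `dim J ≤ m + 1 < 2(m + 1)`.
  obtain ⟨k, hk⟩ : ∃ k, 1 < finrank ℂ (W' k) := by
    by_contra! hle
    have h1 := Submodule.finrank_iSup_le_sum W'
    have h2 : ∑ k, finrank ℂ (W' k) ≤ ∑ _k : Fin (m + 1), 1 := Finset.sum_le_sum fun k _ => hle k
    rw [hJ'] at h1
    simp at h2
    omega
  obtain ⟨w, hwk, n, hw⟩ := (hW' k).1.exists_hasPrimitiveVectorWith (hW' k).2.1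
  have hn := (hW' k).finrank_eq hwk hw
  -- The nonzero vectors of `P` are the primitive vectors of weight `n` for `t'` in `J`. Since the
  -- triples commute, `P` is stable under `t`, and a `t`-primitive vector of `P` is primitive for
  -- both.
  let P : Submodule ℂ V := J ⊓ (End.eigenspace h' (n : ℂ) ⊓ LinearMap.ker e')
  have hP {x : V} : x ∈ P ↔ x ∈ J ∧ h' x = (n : ℂ) • x ∧ e' x = 0 := by
    simp only [P, Submodule.mem_inf, LinearMap.mem_ker, Module.End.mem_eigenspace_iff]
  have hPmem (g : Module.End ℂ V) (hgh : Commute g h') (hge : Commute g e')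
      {x : V} (hx : x ∈ P) (hgx : g x ∈ J) : g x ∈ P := by
    rw [hP] at hx ⊢
    refine ⟨hgx, ?_, ?_⟩
    · rw [← Module.End.mul_apply, ← hgh.eq, Module.End.mul_apply, hx.2.1, map_smul]
    · rw [← Module.End.mul_apply, ← hge.eq, Module.End.mul_apply, hx.2.2, map_zero]
  have hstP : t.Stabilizes P := fun x hx =>
    have hJx := hstJ x (hP.1 hx).1
    ⟨hPmem h hh.1 hh.2.1 hx hJx.1, hPmem e he.1 he.2.1 hx hJx.2.1, hPmem f hf.1 hf.2.1 hx hJx.2.2⟩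
  have hwP : w ∈ P := hP.2 ⟨hJ' ▸ Submodule.mem_iSup_of_mem k hwk, hw.lie_h, hw.lie_e⟩
  obtain ⟨v, hvP, p, hv⟩ := hstP.exists_hasPrimitiveVectorWith
    fun h0 => hw.ne_zero (by simpa [h0] using hwP)
  obtain ⟨hvJ, hv1, hv2⟩ := hP.1 hvP
  obtain rfl : p = m := weight_eq_of_mem_sup h₀ h₁ hd d₀ d₁ (hJ ▸ hvJ) hv
  have hv' : t'.HasPrimitiveVectorWith v (n : ℂ) := ⟨hv.ne_zero, hv1, hv2⟩
  have hli := linearIndependent_pow_pow t t' hh.2.2.symm he.2.2.symm hf.1 hv hv'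
  have hle : Submodule.span ℂ (Set.range fun q : Fin (n + 1) × Fin (p + 1) =>
      (f ^ (q.2 : ℕ)) ((f' ^ (q.1 : ℕ)) v)) ≤ J := by
    rw [Submodule.span_le]
    rintro _ ⟨q, rfl⟩
    exact hstJ.pow_f_mem (hst'J.pow_f_mem hvJ _) _
  have hcard := finrank_span_eq_card hli
  have hcard' := Submodule.finrank_mono hle
  rw [Fintype.card_prod, Fintype.card_fin, Fintype.card_fin] at hcard
  -- Independence gives `(n + 1)(m + 1) ≤ 2(m + 1)`, while `n + 1 = dim W' k > 1`.
  obtain rfl : n = 1 := by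
    rw [hcard, hdim] at hcard'
    have := Nat.le_of_mul_le_mul_right hcard' p.succ_pos
    omega
  exact ⟨v, hv, hv', (Submodule.eq_of_le_of_finrank_eq hle (by rw [hcard, hdim])).symm⟩

end Commuting

end IsSl2Triple

namespace LeibnizAlgebra

/-! ### The standard basis of `sl₂` and its adjoint Casimir operator. -/

namespace Sl2

/-- The diagonal matrix `diag(1, -1)`. -/
def H : Sl2 := ⟨!![1, 0; 0, -1], by simp [LieAlgebra.SpecialLinear.sl, Matrix.trace_fin_two]⟩

/-- The strictly upper triangular matrix unit. -/
def E : Sl2 := ⟨!![0, 1; 0, 0], by simp [LieAlgebra.SpecialLinear.sl, Matrix.trace_fin_two]⟩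

/-- The strictly lower triangular matrix unit. -/
def F : Sl2 := ⟨!![0, 0; 1, 0], by simp [LieAlgebra.SpecialLinear.sl, Matrix.trace_fin_two]⟩

theorem lie_E_F : ⁅E, F⁆ = H := by
  apply Subtype.ext
  rw [LieAlgebra.SpecialLinear.sl_bracket]
  simp [E, F, H]

theorem lie_H_E : ⁅H, E⁆ = (2 : ℂ) • E := by
  apply Subtype.ext
  rw [LieAlgebra.SpecialLinear.sl_bracket]
  ext i j
  fin_cases i <;> fin_cases j <;> simp [E, H]
  norm_num

theorem lie_H_F : ⁅H, F⁆ = -((2 : ℂ) • F) := by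
  apply Subtype.ext
  rw [LieAlgebra.SpecialLinear.sl_bracket]
  ext i j
  fin_cases i <;> fin_cases j <;> simp [F, H]
  norm_num

theorem H_ne_zero : H ≠ 0 := fun h => by
  have := congrFun₂ (congrArg Subtype.val h) 0 0
  simp [H] at this

theorem isSl2Triple : IsSl2Triple H E F :=
  ⟨H_ne_zero, lie_E_F, by rw [lie_H_E, two_smul, two_smul], by rw [lie_H_F, two_smul, two_smul]⟩

theorem eq_combination (a : Sl2) : a = a.1 0 0 • H + a.1 0 1 • E + a.1 1 0 • F := by
  have ha : a.1 0 0 + a.1 1 1 = 0 := by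
    have := a.2
    simpa [LieAlgebra.SpecialLinear.sl, Matrix.trace_fin_two] using this
  apply Subtype.ext
  ext i j
  fin_cases i <;> fin_cases j <;> simp [H, E, F]
  exact eq_neg_of_add_eq_zero_right ha

/-- The adjoint representation has highest weight 2, and `2 · (2 + 2) = 8`; the identity is checked
on `H`, `E`, `F`. -/
theorem adjoint_casimir (b : Sl2) :
    ⁅H, ⁅H, b⁆⁆ + (2 : ℂ) • ⁅H, b⁆ + (4 : ℂ) • ⁅F, ⁅E, b⁆⁆ = (8 : ℂ) • b := by
  have hEH : ⁅E, H⁆ = -((2 : ℂ) • E) := by rw [← lie_skew, lie_H_E]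
  have hFE : ⁅F, E⁆ = -H := by rw [← lie_skew, lie_E_F]
  have hFH : ⁅F, H⁆ = (2 : ℂ) • F := by rw [← lie_skew, lie_H_F, neg_neg]
  rw [eq_combination b]
  simp only [lie_add, lie_smul, lie_self, lie_H_E, lie_H_F, lie_E_F, hEH, hFE, hFH, lie_neg, lie_zero,
    smul_zero]
  module

end Sl2

/-! ### The right action rewritten as a left action. -/

variable (F : Type*) {L : Type*} [Field F] [LeibnizRing L] [LeibnizAlgebra F L]

/-- The left action `(a, x) ↦ -[x, a]` of the Lie algebra `L / I` on `L`. -/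
def leftAct : AssocLie F L →ₗ⁅F⁆ Module.End F L where
  toLinearMap := -(rightAct F L).flip
  map_lie' := by
    intro a b
    induction a using Submodule.Quotient.induction_on with
    | H a =>
    induction b using Submodule.Quotient.induction_on with
    | H b =>
    ext x
    simp only [bracket_mk, AddHom.toFun_eq_coe, LinearMap.coe_toAddHom, LinearMap.neg_apply,
      LinearMap.flip_apply, rightAct_mk, LieRing.of_associative_ring_bracket, LinearMap.sub_apply,
      Module.End.mul_apply, map_neg, neg_neg, LeibnizRing.leibniz]
    abel

theorem leftAct_apply (a : AssocLie F L) (x : L) : leftAct F a x = -rightAct F L x a := rfl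

theorem leftAct_mk (x a : L) : leftAct F (Submodule.Quotient.mk a) x = -⁅x, a⁆ := rfl

/-- Modulo `I` the bracket is antisymmetric, so the action induced on the quotient is the adjoint
one. -/
theorem mk_leftAct (a : AssocLie F L) (x : L) :
    (Submodule.Quotient.mk (leftAct F a x) : AssocLie F L) = ⁅a, Submodule.Quotient.mk x⁆ := by
  induction a using Submodule.Quotient.induction_on with
  | H a => rw [leftAct_mk, Submodule.Quotient.mk_neg, ← bracket_mk, lie_skew]

/-! ### Splitting the projection `L → sl₂ ⊕ sl₂` with a Casimir operator. -/

section Splitting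

variable {L : Type*} [LeibnizRing L] [LeibnizAlgebra ℂ L]
  (ψ : AssocLie ℂ L ≃ₗ⁅ℂ⁆ (Sl2 × Sl2))

/-- The left action of `sl₂ ⊕ sl₂` on `L`. -/
noncomputable def act : Sl2 × Sl2 →ₗ⁅ℂ⁆ Module.End ℂ L := (leftAct ℂ).comp ψ.symm.toLieHom

/-- The projection of `L` onto `sl₂ ⊕ sl₂`. -/
noncomputable def proj : L →ₗ[ℂ] Sl2 × Sl2 :=
  ψ.toLinearEquiv.toLinearMap ∘ₗ (squaresIdeal ℂ L).mkQ

theorem proj_surjective : Function.Surjective (proj ψ) :=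
  ψ.surjective.comp (Submodule.mkQ_surjective _)

theorem proj_eq_zero_iff {x : L} : proj ψ x = 0 ↔ x ∈ squaresIdeal ℂ L := by
  rw [← Submodule.Quotient.mk_eq_zero]
  exact ψ.toLinearEquiv.map_eq_zero_iff

theorem proj_act (a : Sl2 × Sl2) (x : L) : proj ψ (act ψ a x) = ⁅a, proj ψ x⁆ := by
  change ψ (Submodule.Quotient.mk (leftAct ℂ (ψ.symm a) x)) = ⁅a, ψ (Submodule.Quotient.mk x)⁆
  rw [mk_leftAct, LieEquiv.map_lie, LieEquiv.apply_symm_apply]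

theorem bracket_eq_neg_act (x y : L) : ⁅x, y⁆ = -act ψ (proj ψ y) x := by
  change _ = -leftAct ℂ (ψ.symm (ψ (Submodule.Quotient.mk y))) x
  rw [LieEquiv.symm_apply_apply, leftAct_mk, neg_neg]

/-- The left action of the first copy of `sl₂`. -/
noncomputable def act₁ : Sl2 →ₗ⁅ℂ⁆ Module.End ℂ L := (act ψ).comp (LieHom.inl ℂ Sl2 Sl2)

/-- The left action of the second copy of `sl₂`. -/
noncomputable def act₂ : Sl2 →ₗ⁅ℂ⁆ Module.End ℂ L := (act ψ).comp (LieHom.inr ℂ Sl2 Sl2)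

theorem act_eq (a b : Sl2) : act ψ (a, b) = act₁ ψ a + act₂ ψ b := by
  change _ = act ψ (a, 0) + act ψ (0, b)
  rw [← map_add, Prod.mk_add_mk, add_zero, zero_add]

theorem commute_act₁_act₂ (a b : Sl2) : Commute (act₁ ψ a) (act₂ ψ b) := by
  rw [commute_iff_lie_eq]
  change ⁅act ψ (a, 0), act ψ (0, b)⁆ = 0
  rw [← LieHom.map_lie]
  have : ⁅((a, 0) : Sl2 × Sl2), ((0, b) : Sl2 × Sl2)⁆ = 0 := by
    change (⁅a, (0 : Sl2)⁆, ⁅(0 : Sl2), b⁆) = 0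
    rw [lie_zero, zero_lie]; rfl
  rw [this, map_zero]

/-- `IsSl2Triple` demands a nonzero `h`. Here this is visible on the quotient, where `H` acts on `E`
as the scalar 2. -/
theorem act₁_H_ne_zero : act₁ ψ Sl2.H ≠ 0 := fun h => by
  obtain ⟨x, hx⟩ := proj_surjective ψ (Sl2.E, 0)
  have h1 := proj_act ψ (Sl2.H, 0) x
  rw [show act ψ (Sl2.H, 0) = 0 from h, hx, LinearMap.zero_apply, map_zero] at h1
  have h2 : ⁅Sl2.H, Sl2.E⁆ = 0 := (congrArg Prod.fst h1).symm
  rw [Sl2.lie_H_E] at h2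
  exact Sl2.isSl2Triple.e_ne_zero ((smul_eq_zero_iff_right two_ne_zero).1 h2)

theorem act₂_H_ne_zero : act₂ ψ Sl2.H ≠ 0 := fun h => by
  obtain ⟨x, hx⟩ := proj_surjective ψ (0, Sl2.E)
  have h1 := proj_act ψ (0, Sl2.H) x
  rw [show act ψ (0, Sl2.H) = 0 from h, hx, LinearMap.zero_apply, map_zero] at h1
  have h2 : ⁅Sl2.H, Sl2.E⁆ = 0 := (congrArg Prod.snd h1).symm
  rw [Sl2.lie_H_E] at h2
  exact Sl2.isSl2Triple.e_ne_zero ((smul_eq_zero_iff_right two_ne_zero).1 h2)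

theorem _root_.IsSl2Triple.map {K A B : Type*} [CommRing K] [LieRing A] [LieAlgebra K A]
    [LieRing B] [LieAlgebra K B] {h e f : A} (t : IsSl2Triple h e f) (g : A →ₗ⁅K⁆ B)
    (hg : g h ≠ 0) : IsSl2Triple (g h) (g e) (g f) :=
  ⟨hg, by rw [← LieHom.map_lie, t.lie_e_f],
    by rw [← LieHom.map_lie, t.lie_h_e_nsmul, map_nsmul],
    by rw [← LieHom.map_lie, t.lie_h_f_nsmul, map_neg, map_nsmul]⟩

theorem triple₁ : IsSl2Triple (act₁ ψ Sl2.H) (act₁ ψ Sl2.E) (act₁ ψ Sl2.F) :=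
  Sl2.isSl2Triple.map _ (act₁_H_ne_zero ψ)

theorem triple₂ : IsSl2Triple (act₂ ψ Sl2.H) (act₂ ψ Sl2.E) (act₂ ψ Sl2.F) :=
  Sl2.isSl2Triple.map _ (act₂_H_ne_zero ψ)

theorem map_sl2_eq {N : Type*} [AddCommGroup N] [Module ℂ N] (g : Sl2 →ₗ[ℂ] N) (a : Sl2) :
    g a = a.1 0 0 • g Sl2.H + a.1 0 1 • g Sl2.E + a.1 1 0 • g Sl2.F := by
  conv_lhs => rw [Sl2.eq_combination a]
  simp only [map_add, map_smul]

theorem commute_casimir (a : Sl2 × Sl2) : Commute (act ψ a) (triple₂ ψ).casimir := by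
  obtain ⟨a, b⟩ := a
  obtain ⟨hH, hE, hF⟩ := (triple₂ ψ).commute_casimir
  have hb : act₂ ψ b = _ := map_sl2_eq (act₂ ψ).toLinearMap b
  rw [act_eq, hb]
  exact ((triple₂ ψ).commute_casimir_of_commute (commute_act₁_act₂ ψ _ _)
    (commute_act₁_act₂ ψ _ _) (commute_act₁_act₂ ψ _ _)).add_left
    (((hH.smul_left _).add_left (hE.smul_left _)).add_left (hF.smul_left _))

/-- On the quotient the second triple acts by the adjoint action of the second factor, so it kills
the first factor and its Casimir is 8 on the second. -/
theorem proj_casimir (x : L) :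
    proj ψ ((triple₂ ψ).casimir x) = (8 : ℂ) • (0, (proj ψ x).2) := by
  have h (a : Sl2) (y : L) : proj ψ (act₂ ψ a y) = (0, ⁅a, (proj ψ y).2⁆) := by
    refine (proj_act ψ (0, a) y).trans ?_
    change (⁅(0 : Sl2), (proj ψ y).1⁆, _) = _
    rw [zero_lie]
  simp only [IsSl2Triple.casimir, LinearMap.add_apply, LinearMap.smul_apply, Module.End.mul_apply,
    map_add, map_smul, h]
  simp [Sl2.adjoint_casimir]

/-- The Casimir operator of the second copy of `sl₂` splits the projection of `L` onto
`sl₂ ⊕ sl₂` when it acts on `I` as the scalar `3`. -/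
theorem exists_section (h3 : ∀ x ∈ squaresIdeal ℂ L, (triple₂ ψ).casimir x = (3 : ℂ) • x) :
    ∃ σ : Sl2 × Sl2 →ₗ[ℂ] L, (∀ a, proj ψ (σ a) = a) ∧ ∀ a b, ⁅σ a, σ b⁆ = σ ⁅a, b⁆ := by
  set C := (triple₂ ψ).casimir with hC
  -- The polynomial `C(C - 8)` annihilates the quotient, where `C` has eigenvalues 0 and 8, and is
  -- the scalar `3 · (3 - 8) = -15` on `I`. So `ker Q` is a complement of `I`.
  let Q : Module.End ℂ L := C * (C - (8 : ℂ) • 1)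
  have hQ (x : L) : Q x = C (C x) - (8 : ℂ) • C x := by
    simp [Q, Module.End.mul_apply]
  have hQI {x : L} (hx : x ∈ squaresIdeal ℂ L) : Q x = (-15 : ℂ) • x := by
    rw [hQ, h3 x hx, map_smul, h3 x hx]; module
  have hQmem (x : L) : Q x ∈ squaresIdeal ℂ L := by
    rw [← proj_eq_zero_iff ψ, hQ, map_sub, map_smul, proj_casimir, proj_casimir]
    simp
  have hQcomm (a : Sl2 × Sl2) : Commute (act ψ a) Q :=
    (commute_casimir ψ a).mul_right ((commute_casimir ψ a).sub_right
      ((Commute.one_right _).smul_right _))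
  let S := LinearMap.ker Q
  have hinj : Function.Injective (proj ψ ∘ₗ S.subtype) := by
    rw [← LinearMap.ker_eq_bot, LinearMap.ker_eq_bot']
    rintro ⟨x, hx⟩ h0
    have h1 : Q x = (-15 : ℂ) • x := hQI ((proj_eq_zero_iff ψ).1 h0)
    rw [LinearMap.mem_ker.1 hx, eq_comm, smul_eq_zero] at h1
    exact Subtype.ext (h1.resolve_left (by norm_num))
  have hsurj : Function.Surjective (proj ψ ∘ₗ S.subtype) := fun a => by
    obtain ⟨x, rfl⟩ := proj_surjective ψ a
    -- As `Q x` lies in `I`, `Q (Q x) = -15 Q x`; this correction lands in `ker Q` without changing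
    -- the projection.
    refine ⟨⟨x + (15⁻¹ : ℂ) • Q x, ?_⟩, ?_⟩
    · rw [LinearMap.mem_ker, map_add, map_smul, hQI (hQmem x)]; module
    · change proj ψ (x + (15⁻¹ : ℂ) • Q x) = _
      rw [map_add, map_smul, (proj_eq_zero_iff ψ).2 (hQmem x), smul_zero, add_zero]
  let φ := LinearEquiv.ofBijective _ ⟨hinj, hsurj⟩
  have hφ (a : Sl2 × Sl2) : proj ψ (φ.symm a : L) = a := φ.apply_symm_apply a
  refine ⟨S.subtype ∘ₗ φ.symm.toLinearMap, hφ, fun a b => ?_⟩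
  change ⁅(φ.symm a : L), (φ.symm b : L)⁆ = (φ.symm ⁅a, b⁆ : L)
  rw [bracket_eq_neg_act ψ, hφ]
  -- `Q` commutes with the action, so the bracket of two lifts stays in `ker Q`. There the
  -- projection is injective, and comparing projections identifies the bracket.
  have hmem : -act ψ b (φ.symm a : L) ∈ S := by
    rw [LinearMap.mem_ker, map_neg, ← Module.End.mul_apply, ← (hQcomm b).eq, Module.End.mul_apply,
      LinearMap.mem_ker.1 (φ.symm a).2, map_zero, neg_zero]
  have h1 : (⟨_, hmem⟩ : S) = φ.symm ⁅a, b⁆ := by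
    rw [LinearEquiv.eq_symm_apply]
    change proj ψ (-act ψ b (φ.symm a : L)) = _
    rw [map_neg, proj_act, hφ, lie_skew]
  exact congrArg Subtype.val h1

end Splitting

/-! ### Irreducible right modules as irreducible spaces for a triple. -/

section Irreducible

variable {L : Type*} [LeibnizRing L] [LeibnizAlgebra ℂ L]

/-- `H`, `E`, `F` span `sl₂`, and the sign between the left and right actions does not affect
stability. -/
theorem isRightSubmodule_range_iff (g : Sl2 →ₗ⁅ℂ⁆ AssocLie ℂ L) (N : Submodule ℂ L)
    (t : IsSl2Triple (leftAct ℂ (g Sl2.H)) (leftAct ℂ (g Sl2.E)) (leftAct ℂ (g Sl2.F))) :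
    IsRightSubmodule g.range N ↔ t.Stabilizes N := by
  constructor
  · exact fun h x hx => ⟨N.neg_mem (h x hx _ ⟨_, rfl⟩), N.neg_mem (h x hx _ ⟨_, rfl⟩),
      N.neg_mem (h x hx _ ⟨_, rfl⟩)⟩
  · rintro h x hx _ ⟨a, rfl⟩
    have ha : leftAct ℂ (g a) x = _ := map_sl2_eq
      (LinearMap.applyₗ x ∘ₗ ((leftAct ℂ).comp g : Sl2 →ₗ[ℂ] Module.End ℂ L)) a
    have hmem : leftAct ℂ (g a) x ∈ N := by
      rw [ha]
      exact N.add_mem (N.add_mem (N.smul_mem _ (h x hx).1) (N.smul_mem _ (h x hx).2.1))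
        (N.smul_mem _ (h x hx).2.2)
    rw [leftAct_apply] at hmem
    exact neg_mem_iff.1 hmem

theorem IsIrreducibleRightModule.actsIrreducibly {g : Sl2 →ₗ⁅ℂ⁆ AssocLie ℂ L} {N : Submodule ℂ L}
    (h : IsIrreducibleRightModule g.range N)
    (t : IsSl2Triple (leftAct ℂ (g Sl2.H)) (leftAct ℂ (g Sl2.E)) (leftAct ℂ (g Sl2.F))) :
    t.ActsIrreducibly N :=
  ⟨(isRightSubmodule_range_iff g N t).1 h.1, h.2.1, fun N' hle hN' =>
    h.2.2 N' hle ((isRightSubmodule_range_iff g N' t).2 hN')⟩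

end Irreducible

/-! ### The comparison map from the explicit algebra to `L`. -/

namespace ExplicitAlgebra

variable {L : Type*} [LeibnizRing L] [LeibnizAlgebra ℂ L]
  (ψ : AssocLie ℂ L ≃ₗ⁅ℂ⁆ (Sl2 × Sl2)) (σ : Sl2 × Sl2 →ₗ[ℂ] L) (v : L) {m : ℕ}

/-- The generators of the two strings `x_k^1`, `x_k^2` over a highest weight vector `v`. -/
noncomputable def stringHead : Fin 2 → L := ![-act₂ ψ Sl2.F v, v]

/-- The images in `L` of the basis vectors of the explicit algebra. -/
noncomputable def image : BasisIndex m → L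
  -- The table has `[e, h] = 2e` where the standard basis has `[H, E] = 2E`; the triple `E, -F, -H`
  -- meets all three relations of the table.
  | .e i => σ (![(Sl2.E, 0), (0, Sl2.E)] i)
  | .f i => σ (![(-Sl2.F, 0), (0, -Sl2.F)] i)
  | .h i => σ (![(-Sl2.H, 0), (0, -Sl2.H)] i)
  | .x i k => (act₁ ψ Sl2.F ^ (k : ℕ)) (stringHead ψ v i)

/-- The linear map from the explicit algebra to `L` given by the images of the basis vectors. -/
noncomputable def toLeibniz : ExplicitAlgebra m →ₗ[ℂ] L := (basis m).constr ℂ (image ψ σ v)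

theorem toLeibniz_basis (b : BasisIndex m) : toLeibniz ψ σ v (basis m b) = image ψ σ v b := by
  simp [toLeibniz]

/-- The element of the explicit algebra which lifts an element of `sl₂ ⊕ sl₂`. -/
noncomputable def lift (m : ℕ) : Sl2 × Sl2 →ₗ[ℂ] ExplicitAlgebra m where
  toFun p := (p.1.1 0 1 • ve 0 - p.1.1 1 0 • vf 0 - p.1.1 0 0 • vh 0) +
    (p.2.1 0 1 • ve 1 - p.2.1 1 0 • vf 1 - p.2.1 0 0 • vh 1)
  map_add' p q := by
    have h (a b : Sl2) (i j : Fin 2) : (a + b).1 i j = a.1 i j + b.1 i j := rfl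
    rw [Prod.fst_add, Prod.snd_add]
    simp only [h]
    module
  map_smul' c p := by
    have h (a : Sl2) (i j : Fin 2) : (c • a).1 i j = c * a.1 i j := rfl
    rw [Prod.smul_fst, Prod.smul_snd]
    simp only [h, RingHom.id_apply]
    module

section

variable {ψ σ v} (hv : (triple₁ ψ).HasPrimitiveVectorWith v (m : ℂ))
  (hv' : (triple₂ ψ).HasPrimitiveVectorWith v ((1 : ℕ) : ℂ))

include hv' in
theorem act₂_F_apply_ne_zero : act₂ ψ Sl2.F v ≠ 0 := by
  simpa using (triple₂ ψ).pow_f_apply_ne_zero hv' le_rfl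

include hv hv' in
theorem stringHead_hasPrimitiveVectorWith (i : Fin 2) :
    (triple₁ ψ).HasPrimitiveVectorWith (stringHead ψ v i) (m : ℂ) := by
  fin_cases i
  · have := hv.map_of_commute (g := -act₂ ψ Sl2.F) (commute_act₁_act₂ ψ _ _).symm.neg_left
      (commute_act₁_act₂ ψ _ _).symm.neg_left
      (neg_ne_zero.2 (act₂_F_apply_ne_zero hv'))
    exact this
  · exact hv

include hv' in
-- The second triple acts on `v`, `F v` as on a two-dimensional module of highest weight 1. The
-- minus sign in `stringHead` produces the signs of the table.
theorem act₂_stringHead [FiniteDimensional ℂ L] :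
    act₂ ψ Sl2.E (stringHead ψ v 0) = -stringHead ψ v 1 ∧ act₂ ψ Sl2.E (stringHead ψ v 1) = 0 ∧
    act₂ ψ Sl2.H (stringHead ψ v 0) = -stringHead ψ v 0 ∧
    act₂ ψ Sl2.H (stringHead ψ v 1) = stringHead ψ v 1 ∧
    act₂ ψ Sl2.F (stringHead ψ v 0) = 0 ∧
    act₂ ψ Sl2.F (stringHead ψ v 1) = -stringHead ψ v 0 := by
  have h1 := (triple₂ ψ).h_pow_f_apply hv' 1
  have h2 := (triple₂ ψ).e_pow_succ_f_apply hv' 0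
  have h3 := (triple₂ ψ).pow_f_apply_eq_zero hv' (show 1 < 2 by norm_num)
  have h4 : act₂ ψ Sl2.H v = ((1 : ℕ) : ℂ) • v := hv'.lie_h
  have h5 : act₂ ψ Sl2.E v = 0 := hv'.lie_e
  rw [pow_two, Module.End.mul_apply] at h3
  norm_num at h1 h2 h4
  simp [stringHead, h1, h2, h3, h4, h5]

theorem act₂_pow_act₁ (a b : Sl2) (k : ℕ) (x : L) :
    act₂ ψ a ((act₁ ψ b ^ k) x) = (act₁ ψ b ^ k) (act₂ ψ a x) := by
  rw [← Module.End.mul_apply, ← ((commute_act₁_act₂ ψ b a).pow_left k).eq, Module.End.mul_apply]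

include hv hv' in
-- Beyond `k = m` both sides vanish, so `[x_m^i, f_1] = 0` needs no separate treatment.
theorem toLeibniz_vx [FiniteDimensional ℂ L] (i : Fin 2) (k : ℕ) :
    toLeibniz ψ σ v (vx (m := m) i k) = (act₁ ψ Sl2.F ^ k) (stringHead ψ v i) := by
  by_cases hk : k < m + 1
  · rw [vx, dif_pos hk, toLeibniz_basis]; rfl
  · rw [vx, dif_neg hk, map_zero, (triple₁ ψ).pow_f_apply_eq_zero
      (stringHead_hasPrimitiveVectorWith hv hv' i) (by omega)]

include hv hv' in
theorem linearIndependent_string [FiniteDimensional ℂ L] :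
    LinearIndependent ℂ fun p : Fin (1 + 1) × Fin (m + 1) =>
      (act₁ ψ Sl2.F ^ (p.2 : ℕ)) ((act₂ ψ Sl2.F ^ (p.1 : ℕ)) v) :=
  (triple₁ ψ).linearIndependent_pow_pow (triple₂ ψ) (commute_act₁_act₂ ψ _ _).symm
    (commute_act₁_act₂ ψ _ _).symm (commute_act₁_act₂ ψ _ _) hv hv'

include hv hv' in
theorem toLeibniz_injective [FiniteDimensional ℂ L]
    (hvI : ∀ i k, image (m := m) ψ σ v (.x i k) ∈ squaresIdeal ℂ L)
    (hσ : ∀ a, proj ψ (σ a) = a) : Function.Injective (toLeibniz (m := m) ψ σ v) := by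
  obtain ⟨g, hg⟩ := LinearMap.exists_leftInverse_of_injective _
    (LinearMap.ker_eq_bot.2 (linearIndependent_string hv hv'))
  -- `T` reads off string coordinates: index 0 is the string over `v`, that is `x^2`, and index 1
  -- the string over `F v`, that is `-x^1`.
  let T : L →ₗ[ℂ] ExplicitAlgebra m := Finsupp.linearCombination ℂ
    (fun p : Fin (1 + 1) × Fin (m + 1) => ![vx 1 p.2, -vx 0 p.2] p.1) ∘ₗ g
  have hT (p : Fin (1 + 1) × Fin (m + 1)) :
      T ((act₁ ψ Sl2.F ^ (p.2 : ℕ)) ((act₂ ψ Sl2.F ^ (p.1 : ℕ)) v)) =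
        ![vx 1 p.2, -vx 0 p.2] p.1 := by
    have := LinearMap.congr_fun hg (Finsupp.single p 1)
    rw [LinearMap.comp_apply, Finsupp.linearCombination_single, one_smul] at this
    rw [LinearMap.comp_apply, this]
    simp
  have hTx (i : Fin 2) (k : Fin (m + 1)) : T (image ψ σ v (.x i k)) = basis m (.x i k) := by
    rw [basis_x]
    fin_cases i
    · simpa [image, stringHead] using congrArg Neg.neg (hT (1, k))
    · simpa [image, stringHead] using hT (0, k)
  -- A left inverse: `id - σ ∘ proj` projects onto `I` along the image of `σ`, so the two terms
  -- recover the `I` part and the `sl₂ ⊕ sl₂` part separately.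
  let Ψ : L →ₗ[ℂ] ExplicitAlgebra m :=
    lift m ∘ₗ proj ψ + T ∘ₗ (LinearMap.id - σ ∘ₗ proj ψ)
  have hΨσ (a : Sl2 × Sl2) : Ψ (σ a) = lift m a := by simp [Ψ, hσ]
  have hΨ : Ψ ∘ₗ toLeibniz ψ σ v = LinearMap.id := by
    refine (basis m).ext fun b => ?_
    rw [LinearMap.comp_apply, toLeibniz_basis, LinearMap.id_apply]
    rcases b with i | i | i | ⟨i, k⟩
    case x =>
      have := (proj_eq_zero_iff ψ).2 (hvI i k)
      simp [Ψ, this, hTx]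
    all_goals
      refine (hΨσ _).trans ?_
      fin_cases i <;> simp [lift, Sl2.E, Sl2.F, Sl2.H, ve, vf, vh]
  exact Function.LeftInverse.injective (g := Ψ) (LinearMap.congr_fun hΨ)

theorem toLeibniz_surjective [FiniteDimensional ℂ L]
    (hI : squaresIdeal ℂ L = Submodule.span ℂ (Set.range fun p : Fin (1 + 1) × Fin (m + 1) =>
      (act₁ ψ Sl2.F ^ (p.2 : ℕ)) ((act₂ ψ Sl2.F ^ (p.1 : ℕ)) v)))
    (hσ : ∀ a, proj ψ (σ a) = a) : Function.Surjective (toLeibniz (m := m) ψ σ v) := by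
  have hx (i : Fin 2) (k : Fin (m + 1)) : (act₁ ψ Sl2.F ^ (k : ℕ)) (stringHead ψ v i) ∈
      LinearMap.range (toLeibniz (m := m) ψ σ v) := ⟨_, toLeibniz_basis ψ σ v (.x i k)⟩
  have hIle : squaresIdeal ℂ L ≤ LinearMap.range (toLeibniz (m := m) ψ σ v) := by
    rw [hI, Submodule.span_le]
    rintro _ ⟨⟨i, k⟩, rfl⟩
    fin_cases i
    · simpa [stringHead] using hx 1 k
    · simpa [stringHead] using hx 0 k
  have hσle (p : Sl2 × Sl2) : σ p ∈ LinearMap.range (toLeibniz (m := m) ψ σ v) := by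
    obtain ⟨a, b⟩ := p
    have h1 := toLeibniz_basis (m := m) ψ σ v (.e 0)
    have h2 := toLeibniz_basis (m := m) ψ σ v (.f 0)
    have h3 := toLeibniz_basis (m := m) ψ σ v (.h 0)
    have h4 := toLeibniz_basis (m := m) ψ σ v (.e 1)
    have h5 := toLeibniz_basis (m := m) ψ σ v (.f 1)
    have h6 := toLeibniz_basis (m := m) ψ σ v (.h 1)
    refine ⟨lift m (a, b), ?_⟩
    simp only [lift, LinearMap.coe_mk, AddHom.coe_mk, map_add, map_sub, map_smul, ve, vf, vh,
      h1, h2, h3, h4, h5, h6, image]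
    simp only [← map_smul σ, ← map_sub σ, ← map_add σ]
    congr 1
    conv_rhs => rw [Sl2.eq_combination a, Sl2.eq_combination b]
    ext1 <;> simp <;> module
  rw [← LinearMap.range_eq_top, eq_top_iff]
  intro x _
  -- Every `x` is `σ (proj x)` plus an element of `I`.
  rw [← add_sub_cancel (σ (proj ψ x)) x]
  refine Submodule.add_mem _ (hσle _) (hIle ?_)
  rw [← proj_eq_zero_iff ψ, map_sub, hσ, sub_self]

theorem image_x_bracket (hσ : ∀ a, proj ψ (σ a) = a) (i : Fin 2)
    (k : Fin (m + 1)) (a : Sl2 × Sl2) :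
    ⁅image (m := m) ψ σ v (.x i k), σ a⁆ =
      -(act₁ ψ a.1 ((act₁ ψ Sl2.F ^ (k : ℕ)) (stringHead ψ v i)) +
        (act₁ ψ Sl2.F ^ (k : ℕ)) (act₂ ψ a.2 (stringHead ψ v i))) := by
  rw [bracket_eq_neg_act ψ, hσ]
  obtain ⟨a, b⟩ := a
  rw [act_eq, LinearMap.add_apply, image, act₂_pow_act₁]

set_option maxHeartbeats 1000000 in
include hv hv' in
theorem toLeibniz_table [FiniteDimensional ℂ L]
    (hvI : ∀ i k, image (m := m) ψ σ v (.x i k) ∈ squaresIdeal ℂ L)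
    (hσ : ∀ a, proj ψ (σ a) = a) (hσ' : ∀ a b, ⁅σ a, σ b⁆ = σ ⁅a, b⁆) (a b : BasisIndex m) :
    toLeibniz ψ σ v (table a b) = ⁅image ψ σ v a, image ψ σ v b⁆ := by
  have hs (a b : Sl2 × Sl2) : ⁅σ a, σ b⁆ = σ (⁅a.1, b.1⁆, ⁅a.2, b.2⁆) := hσ' a b
  have hEH : ⁅Sl2.E, Sl2.H⁆ = -((2 : ℂ) • Sl2.E) := by rw [← lie_skew, Sl2.lie_H_E]
  have hFE : ⁅Sl2.F, Sl2.E⁆ = -Sl2.H := by rw [← lie_skew, Sl2.lie_E_F]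
  have hFH : ⁅Sl2.F, Sl2.H⁆ = (2 : ℂ) • Sl2.F := by rw [← lie_skew, Sl2.lie_H_F, neg_neg]
  have he (i) : toLeibniz (m := m) ψ σ v (ve i) = _ := toLeibniz_basis ψ σ v (.e i)
  have hf (i) : toLeibniz (m := m) ψ σ v (vf i) = _ := toLeibniz_basis ψ σ v (.f i)
  have hh (i) : toLeibniz (m := m) ψ σ v (vh i) = _ := toLeibniz_basis ψ σ v (.h i)
  have hx := toLeibniz_vx (σ := σ) hv hv'
  have hp := stringHead_hasPrimitiveVectorWith hv hv'
  obtain ⟨hw1, hw2, hw3, hw4, hw5, hw6⟩ := act₂_stringHead hv'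
  -- Naming the restrictions of `σ` to the two factors as linear maps lets signs and scalars be
  -- pulled out of a pair with a zero entry.
  obtain ⟨s₁, hs₁⟩ : ∃ s : Sl2 →ₗ[ℂ] L, ∀ a, σ (a, 0) = s a :=
    ⟨σ ∘ₗ LinearMap.inl ℂ Sl2 Sl2, fun _ => rfl⟩
  obtain ⟨s₂, hs₂⟩ : ∃ s : Sl2 →ₗ[ℂ] L, ∀ a, σ (0, a) = s a :=
    ⟨σ ∘ₗ LinearMap.inr ℂ Sl2 Sl2, fun _ => rfl⟩
  rcases b with j | j | j | ⟨j, l⟩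
  case x =>
    rw [bracket_eq_zero_of_mem ℂ L _ (hvI j l)]
    rcases a with i | i | i | ⟨i, k⟩ <;> exact map_zero _
  all_goals
    rcases a with i | i | i | ⟨i, k⟩
  case e.x =>
    refine Eq.trans ?_ (image_x_bracket hσ i k _).symm
    fin_cases j
    -- The table uses truncated `k - 1`: at `k = 0` its coefficient is 0 and the string head is
    -- killed by `E`.
    · obtain ⟨_ | k, hk⟩ := k
      · have : act₁ ψ Sl2.E (stringHead ψ v i) = 0 := (hp i).lie_e
        simp [table, this]
      · have := (triple₁ ψ).e_pow_succ_f_apply (hp i) k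
        simp only [Fin.zero_eta, table, map_smul, hx, Matrix.cons_val_zero, this, map_zero,
          LinearMap.zero_apply, add_zero, Nat.add_sub_cancel, ← neg_smul]
        congr 1
        push_cast
        ring
    · fin_cases i <;> simp [table, hx, hw1, hw2]
  case f.x =>
    refine Eq.trans ?_ (image_x_bracket hσ i k _).symm
    fin_cases j
    · simp [table, hx, pow_succ']
    · fin_cases i <;> simp [table, hx, hw5, hw6]
  case h.x =>
    refine Eq.trans ?_ (image_x_bracket hσ i k _).symm
    fin_cases j
    · have := (triple₁ ψ).h_pow_f_apply (hp i) k
      simp [table, hx, this]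
    · fin_cases i <;> simp [table, hx, hw3, hw4]
  all_goals
    fin_cases i <;> fin_cases j <;>
      simp [table, he, hf, hh, image, hs, hEH, hFE, hFH, Sl2.lie_H_E, Sl2.lie_H_F, Sl2.lie_E_F] <;>
      simp [hs₁, hs₂]

end

end ExplicitAlgebra

end LeibnizAlgebra

/-! ### Assembly of the isomorphism. -/

open LeibnizAlgebra ExplicitAlgebra in
/-- Let `L` be a finite-dimensional complex Leibniz algebra, `I` its ideal generated by squares,
such that (a) `L / I ≅ sl_2^1 ⊕ sl_2^2`; (b) `I = I_{1,1} ⊕ I_{1,2}` with irreducible right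
`sl_2^1`-modules of the same dimension `m + 1`; (c) `I = I_{2,1} ⊕ ⋯ ⊕ I_{2,m+1}` with irreducible
right `sl_2^2`-modules. Then `L` is isomorphic to the explicit algebra with parameter `m`. -/
theorem theorem4p2 (L : Type*) [LeibnizRing L] [LeibnizAlgebra ℂ L] [FiniteDimensional ℂ L]
    (m : ℕ)
    (ψ : LeibnizAlgebra.AssocLie ℂ L ≃ₗ⁅ℂ⁆ (LeibnizAlgebra.Sl2 × LeibnizAlgebra.Sl2))
    (I₁ : Fin 2 → Submodule ℂ L)
    (hI₁ : LeibnizAlgebra.IsDirectSumOf (LeibnizAlgebra.squaresIdeal ℂ L) I₁)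
    (hI₁_irr : ∀ j, LeibnizAlgebra.IsIrreducibleRightModule (LeibnizAlgebra.firstCopy ψ) (I₁ j))
    (hI₁_dim : ∀ j, Module.finrank ℂ (I₁ j) = m + 1)
    (I₂ : Fin (m + 1) → Submodule ℂ L)
    (hI₂ : LeibnizAlgebra.IsDirectSumOf (LeibnizAlgebra.squaresIdeal ℂ L) I₂)
    (hI₂_irr : ∀ k, LeibnizAlgebra.IsIrreducibleRightModule (LeibnizAlgebra.secondCopy ψ) (I₂ k)) :
    Nonempty (LeibnizAlgebra.Iso ℂ L (LeibnizAlgebra.ExplicitAlgebra m)) := by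
  have hsup : I₁ 0 ⊔ I₁ 1 = squaresIdeal ℂ L := by
    rw [← hI₁.2]
    exact le_antisymm (sup_le (le_iSup I₁ 0) (le_iSup I₁ 1))
      (iSup_le fun i => by fin_cases i; exacts [le_sup_left, le_sup_right])
  obtain ⟨v, hv, hv', hspan⟩ := IsSl2Triple.exists_highest_weight_vector (triple₁ ψ) (triple₂ ψ)
    (by
      rintro g (rfl | rfl | rfl) <;>
        exact ⟨commute_act₁_act₂ ψ _ _, commute_act₁_act₂ ψ _ _, commute_act₁_act₂ ψ _ _⟩)
    ((hI₁_irr 0).actsIrreducibly (triple₁ ψ)) ((hI₁_irr 1).actsIrreducibly (triple₁ ψ))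
    (hI₁.1.pairwiseDisjoint zero_ne_one) hsup (hI₁_dim 0) (hI₁_dim 1)
    (fun k => (hI₂_irr k).actsIrreducibly (triple₂ ψ)) hI₂.2
  have hmem (i : Fin (1 + 1)) (k : Fin (m + 1)) :
      (act₁ ψ Sl2.F ^ (k : ℕ)) ((act₂ ψ Sl2.F ^ (i : ℕ)) v) ∈ squaresIdeal ℂ L := by
    rw [hspan]
    exact Submodule.subset_span ⟨(i, k), rfl⟩
  -- At `v`, of second weight 1, the scalar is `1 · (1 + 2) = 3`. The Casimir commutes with both
  -- lowering operators, which generate `I` from `v`.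
  have hcas : ∀ x ∈ squaresIdeal ℂ L, (triple₂ ψ).casimir x = (3 : ℂ) • x := by
    have hle : squaresIdeal ℂ L ≤ Module.End.eigenspace (triple₂ ψ).casimir 3 := by
      rw [hspan, Submodule.span_le]
      rintro _ ⟨⟨i, k⟩, rfl⟩
      have h1 : Commute (act₁ ψ Sl2.F ^ (k : ℕ) * act₂ ψ Sl2.F ^ (i : ℕ)) (triple₂ ψ).casimir :=
        ((commute_casimir ψ (Sl2.F, 0)).pow_left _).mul_left
          ((commute_casimir ψ (0, Sl2.F)).pow_left _)
      have h2 := (triple₂ ψ).casimir_apply hv'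
      norm_num at h2
      have h3 := LinearMap.congr_fun h1.eq v
      simp only [Module.End.mul_apply, h2, map_smul] at h3
      exact Module.End.mem_eigenspace_iff.2 h3.symm
    exact fun x hx => Module.End.mem_eigenspace_iff.1 (hle hx)
  obtain ⟨σ, hσ, hσ'⟩ := exists_section ψ hcas
  have hvI (i : Fin 2) (k : Fin (m + 1)) :
      image ψ σ v (BasisIndex.x i k) ∈ squaresIdeal ℂ L := by
    fin_cases i
    · simpa [image, stringHead] using hmem 1 k
    · simpa [image, stringHead] using hmem 0 k
  let Φ : ExplicitAlgebra m →ₗ[ℂ] L := toLeibniz ψ σ v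
  have hΦ (x y : ExplicitAlgebra m) : Φ ⁅x, y⁆ = ⁅Φ x, Φ y⁆ := by
    have h1 : (mul m).compr₂ Φ = (bracketLin ℂ L).compl₁₂ Φ Φ := by
      refine (basis m).ext fun a => (basis m).ext fun b => ?_
      change Φ (mul m (basis m a) (basis m b)) = ⁅Φ (basis m a), Φ (basis m b)⁆
      rw [mul_basis, toLeibniz_table hv hv' hvI hσ hσ', toLeibniz_basis, toLeibniz_basis]
    exact LinearMap.congr_fun₂ h1 x y
  let e := LinearEquiv.ofBijective Φ
    ⟨toLeibniz_injective hv hv' hvI hσ, toLeibniz_surjective hspan hσ⟩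
  refine ⟨⟨e.symm, fun x y => ?_⟩⟩
  rw [LinearEquiv.symm_apply_eq]
  refine Eq.trans ?_ (hΦ _ _).symm
  change ⁅x, y⁆ = ⁅e (e.symm x), e (e.symm y)⁆
  rw [LinearEquiv.apply_symm_apply, LinearEquiv.apply_symm_apply]
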